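/- Write $\sigma(x)=1/(1+e^{-x})$ for the logistic sigmoid and $\sigma^{-1}(p)=\log\frac{p}{1-p}$ for its inverse $(0,1)\to\mathbb{R}$. Let $\varphi:\mathbb{R}\to\mathbb{R}$ be any continuous sigmoidal activation function, i.e. $\varphi$ is continuous with $\varphi(x)\to0$ as $x\to-\infty$ and $\varphi(x)\to1$ as $x\to+\infty$. A neural network from $\mathbb{R}^p$ to $\mathbb{R}^q$ is a map $z\mapsto W_2\,\varphi(W_1z+c_1)+c_2$ with one hidden layer of arbitrary finite width, real matrices $W_1,W_2$ and real vectors $c_1,c_2$, where $\varphi$ acts coordinatewise. An autoregressive DSF map on $\mathbb{R}^m$ with $n\ge1$ units is a map $G:\mathbb{R}^m\to\mathbb{R}^m$ of the form $$G(x)_t=\sigma^{-1}\bigl(\mathcal{S}(x_t;\mathcal{C}_t(x_{1:t-1}))\bigr),\qquad \mathcal{S}(x_t;\mathcal{C}_t(x_{1:t-1}))=\sum_{j=1}^{n}w_{tj}(x_{1:t-1})\,\sigma\!\left(\frac{x_t-b_{tj}(x_{1:t-1})}{\tau_{tj}(x_{1:t-1})}\right),\qquad t=1,\dots,m,$$ whose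 conditioner $\mathcal{C}_t=(w_{tj},b_{tj},\tau_{tj})_{j=1}^n$ is given by neural networks $u_t,v_t,s_t:\mathbb{R}^{t-1}\to\mathbb{R}^n$ through $(w_{tj})_j=\operatorname{softmax}(u_t)$, $b_{tj}=\sigma(v_{tj})$ and $\tau_{tj}=\exp(s_{tj})$. (Thus $w_{tj}>0$, $\sum_jw_{tj}=1$, $b_{tj}\in(0,1)$, and $\tau_{tj}$ is positive and bounded.) **Proposition.** Let $Y$ be a random vector in $\mathbb{R}^m$ whose law has a strictly positive continuous density with respect to Lebesgue measure, and let $X$ be uniformly distributed on $(0,1)^m$. Then, for every continuous sigmoidal $\varphi$, there is a sequence $(G_n)_{n\ge1}$ of autoregressive DSF maps, $G_n$ having $n$ units, such that $G_n(X)$ converges in distribution to $Y$ as $n\to\infty$. -/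

import Mathlib

open MeasureTheory Filter Topology

noncomputable section

namespace NAF

/-- A multilayer perceptron with one hidden layer, `p` inputs and `q` linear outputs:
`x ↦ W₂ φ(W₁ x + c₁) + c₂`, where the activation `φ` is applied coordinatewise. -/
structure MLP (p q : ℕ) where
  /-- number of hidden units -/
  width : ℕ
  W₁ : Matrix (Fin width) (Fin p) ℝ
  c₁ : Fin width → ℝ
  W₂ : Matrix (Fin q) (Fin width) ℝ
  c₂ : Fin q → ℝ

/-- The function computed by the network with hidden activation `φ`. -/
def MLP.eval {p q : ℕ} (N : MLP p q) (φ : ℝ → ℝ) (x : Fin p → ℝ) : Fin q → ℝ :=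
  N.W₂.mulVec (fun h => φ (N.W₁.mulVec x h + N.c₁ h)) + N.c₂

/-- Continuous sigmoidal activation functions in the sense of Cybenko. -/
structure IsSigmoidal (φ : ℝ → ℝ) : Prop where
  continuous : Continuous φ
  tendsto_atBot : Tendsto φ atBot (𝓝 0)
  tendsto_atTop : Tendsto φ atTop (𝓝 1)

/-- The softmax function. -/
def softmax {n : ℕ} (u : Fin n → ℝ) (j : Fin n) : ℝ :=
  Real.exp (u j) / ∑ k, Real.exp (u k)

/-- The inverse `σ⁻¹ : (0,1) → ℝ` of the logistic sigmoid. -/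
def logit (p : ℝ) : ℝ := Real.log (p / (1 - p))

/-- The initial segment `x_{1:t-1}` of a vector: with zero-based indices, the coordinates of
index smaller than `t`. -/
def prefixOf {m : ℕ} (x : Fin m → ℝ) (t : Fin m) : Fin (t : ℕ) → ℝ :=
  fun i => x (Fin.castLE t.isLt.le i)

/-- The autoregressive conditioners `(C_t)_t` of a DSF map on `ℝ^m` with `n` sigmoid units in
each coordinate: networks that read `x_{1:t-1}` and output the `n` preactivations of the
weights, of the biases and of the scales. -/
structure DSF (m n : ℕ) where
  wNet : (t : Fin m) → MLP t n
  bNet : (t : Fin m) → MLP t n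
  τNet : (t : Fin m) → MLP t n

namespace DSF

variable {m n : ℕ} (D : DSF m n) (φ : ℝ → ℝ) (t : Fin m)

/-- The weights `w_{tj}` as functions of `z = x_{1:t-1}`. -/
def w (z : Fin (t : ℕ) → ℝ) (j : Fin n) : ℝ := softmax ((D.wNet t).eval φ z) j

/-- The biases `b_{tj} ∈ (0,1)` as functions of `z = x_{1:t-1}`. -/
def b (z : Fin (t : ℕ) → ℝ) (j : Fin n) : ℝ := Real.sigmoid ((D.bNet t).eval φ z j)

/-- The scales `τ_{tj} > 0` as functions of `z = x_{1:t-1}`. -/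
def τ (z : Fin (t : ℕ) → ℝ) (j : Fin n) : ℝ := Real.exp ((D.τNet t).eval φ z j)

/-- The pre-logit `S(x_t; C_t(x_{1:t-1}))`, as a function of `s = x_t` and `z = x_{1:t-1}`. -/
def prelogit (s : ℝ) (z : Fin (t : ℕ) → ℝ) : ℝ :=
  ∑ j, D.w φ t z j * Real.sigmoid ((s - D.b φ t z j) / D.τ φ t z j)

/-- The DSF map `G(x)_t = σ⁻¹(S(x_t; C_t(x_{1:t-1})))`. -/
def eval (x : Fin m → ℝ) : Fin m → ℝ :=
  fun t => logit (D.prelogit φ t (x t) (prefixOf x t))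

end DSF

/-! The facts below show that the parameters obey the constraints of a DSF and that no junk
value of `logit` is used. -/

theorem logit_sigmoid (x : ℝ) : logit (Real.sigmoid x) = x := by
  have h : 1 - Real.sigmoid x = Real.sigmoid x * Real.exp (-x) := by
    rw [Real.sigmoid_mul_rexp_neg, Real.sigmoid_neg]
  have h0 := (Real.sigmoid_pos x).ne'
  rw [logit, h, div_mul_eq_div_div, div_self h0, one_div, ← Real.exp_neg, neg_neg, Real.log_exp]

theorem sigmoid_logit {p : ℝ} (hp : p ∈ Set.Ioo (0 : ℝ) 1) : Real.sigmoid (logit p) = p := by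
  obtain ⟨x, rfl⟩ := Real.range_sigmoid.symm ▸ hp
  rw [logit_sigmoid]

theorem IsSigmoidal.bounded {φ : ℝ → ℝ} (h : IsSigmoidal φ) : ∃ M : ℝ, ∀ x, |φ x| ≤ M := by
  obtain ⟨a, ha⟩ := eventually_atBot.1 (h.tendsto_atBot.abs.eventually_le_const
    (show |(0 : ℝ)| < 2 by norm_num))
  obtain ⟨c, hc⟩ := eventually_atTop.1 (h.tendsto_atTop.abs.eventually_le_const
    (show |(1 : ℝ)| < 2 by norm_num))
  obtain ⟨K, hK⟩ := (isCompact_Icc (a := a) (b := c)).exists_bound_of_continuousOn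
    h.continuous.continuousOn
  refine ⟨max 2 K, fun x => ?_⟩
  rcases le_total x a with hx | hx
  · exact (ha x hx).trans (le_max_left _ _)
  rcases le_total c x with hx' | hx'
  · exact (hc x hx').trans (le_max_left _ _)
  · exact (hK x ⟨hx, hx'⟩).trans (le_max_right _ _)

namespace DSF

variable {m n : ℕ} (D : DSF m (n + 1)) (φ : ℝ → ℝ) (t : Fin m) (z : Fin (t : ℕ) → ℝ)

theorem w_pos (j : Fin (n + 1)) : 0 < D.w φ t z j :=
  div_pos (Real.exp_pos _) (Finset.sum_pos (fun _ _ => Real.exp_pos _) Finset.univ_nonempty)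

theorem sum_w : ∑ j, D.w φ t z j = 1 := by
  simp only [w, softmax]
  rw [← Finset.sum_div]
  exact div_self (Finset.sum_pos (fun _ _ => Real.exp_pos _) Finset.univ_nonempty).ne'

theorem b_mem (j : Fin (n + 1)) : D.b φ t z j ∈ Set.Ioo (0 : ℝ) 1 :=
  ⟨Real.sigmoid_pos _, Real.sigmoid_lt_one _⟩

theorem τ_pos (j : Fin (n + 1)) : 0 < D.τ φ t z j := Real.exp_pos _

theorem τ_bounded (hφ : IsSigmoidal φ) :
    ∃ B : ℝ, ∀ (z : Fin (t : ℕ) → ℝ) (j : Fin (n + 1)), D.τ φ t z j ≤ B := by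
  obtain ⟨M, hM⟩ := hφ.bounded
  let N := D.τNet t
  refine ⟨∑ j, Real.exp (∑ h, |N.W₂ j h| * M + N.c₂ j), fun z j => ?_⟩
  refine le_trans (Real.exp_le_exp.2 ?_) (Finset.single_le_sum
    (f := fun j => Real.exp (∑ h, |N.W₂ j h| * M + N.c₂ j))
    (fun _ _ => (Real.exp_pos _).le) (Finset.mem_univ j))
  simp only [MLP.eval, Pi.add_apply, Matrix.mulVec, dotProduct]
  refine add_le_add (Finset.sum_le_sum fun h _ => ?_) le_rfl
  refine (le_abs_self _).trans ?_
  rw [abs_mul]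
  exact mul_le_mul_of_nonneg_left (hM _) (abs_nonneg _)

theorem prelogit_mem (s : ℝ) : D.prelogit φ t s z ∈ Set.Ioo (0 : ℝ) 1 := by
  constructor
  · exact Finset.sum_pos (fun j _ => mul_pos (D.w_pos φ t z j) (Real.sigmoid_pos _))
      Finset.univ_nonempty
  · rw [← D.sum_w φ t z]
    refine Finset.sum_lt_sum_of_nonempty Finset.univ_nonempty fun j _ => ?_
    exact mul_lt_of_lt_one_right (D.w_pos φ t z j) (Real.sigmoid_lt_one _)

end DSF

end NAF

end

namespace NAF

open ProbabilityTheory Set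

/-! The law of `Y` is the image of the uniform law on the cube under a triangular map `T` built from
conditional quantile functions (Knothe–Rosenblatt, `exists_triangular_map`). `T` is only measurable,
but its `t`-th coordinate is monotone in `x_t`, and this is the structure that a DSF can imitate.

After applying the sigmoid, each coordinate is a monotone function of `x_t` with values in `[0,1]`.
Such a function is a limit of mixtures of steps whose weights are its increments over a grid. Steps
are limits of steep sigmoids, and the weights, measurable functions of the prefix, are a.e. limits
of networks by Cybenko's theorem (`exists_tendsto_networkSpan`). All mixtures are bounded by 1, so
dominated convergence turns each a.e. limit into an `L¹` limit and the limits can be chained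
(`IsMixtureLimit.of_tendsto`).

Padding a mixture with duplicate units gives one approximant for every number of units. Applying
`logit` then gives convergence in measure to `T`, hence convergence in distribution. -/

/-- The uniform distribution on `(0,1)`. -/
noncomputable def unif : Measure ℝ := volume.restrict (Ioo (0 : ℝ) 1)

instance : IsProbabilityMeasure unif := ⟨by simp [unif]⟩

/-- The uniform distribution on `(0,1)^k`. -/
noncomputable def cube (k : ℕ) : Measure (Fin k → ℝ) := Measure.pi fun _ => unif

instance (k : ℕ) : IsProbabilityMeasure (cube k) := by unfold cube; infer_instance

theorem cond_volume_eq_cube (m : ℕ) :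
    ProbabilityTheory.cond volume (univ.pi fun _ : Fin m => Ioo (0 : ℝ) 1) = cube m := by
  rw [ProbabilityTheory.cond, volume_pi, Measure.pi_pi, Measure.restrict_pi_pi]
  simp [cube, unif]

/-! ### Quantile functions. -/

/-- The quantile function of a measure on `ℝ`. -/
noncomputable def quantile (μ : Measure ℝ) (s : ℝ) : ℝ := sInf {y | s ≤ cdf μ y}

/-- Right continuity of the cdf makes the infimum attained; `0 < s < 1` makes the set nonempty and
bounded below. This Galois connection is the only property of quantiles used later. -/
theorem quantile_le_iff (μ : Measure ℝ) {s : ℝ} (hs : s ∈ Ioo (0 : ℝ) 1) (y : ℝ) :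
    quantile μ s ≤ y ↔ s ≤ cdf μ y := by
  have hne : {y | s ≤ cdf μ y}.Nonempty :=
    ((tendsto_cdf_atTop μ).eventually (lt_mem_nhds hs.2)).exists.imp fun _ h => le_of_lt h
  obtain ⟨a, ha⟩ := ((tendsto_cdf_atBot μ).eventually (gt_mem_nhds hs.1)).exists
  have hbdd : BddBelow {y | s ≤ cdf μ y} := by
    refine ⟨a, fun b hb => ?_⟩
    by_contra! h
    exact absurd (hb.trans (monotone_cdf μ h.le)) (not_le.2 ha)
  refine ⟨fun h => le_trans ?_ (monotone_cdf μ h), fun h => csInf_le hbdd h⟩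
  refine ge_of_tendsto (((cdf μ).right_continuous (quantile μ s)).mono_left
    (nhdsWithin_mono _ Ioi_subset_Ici_self)) ?_
  filter_upwards [self_mem_nhdsWithin] with y' hy'
  obtain ⟨c, hc, hcy⟩ := exists_lt_of_csInf_lt hne hy'
  exact le_trans hc (monotone_cdf μ hcy.le)

theorem quantile_monotoneOn (μ : Measure ℝ) : MonotoneOn (quantile μ) (Ioo 0 1) :=
  fun _ hs _ hs' hss' => (quantile_le_iff μ hs _).2 (hss'.trans ((quantile_le_iff μ hs' _).1 le_rfl))

theorem unif_map_eq (μ : Measure ℝ) [IsProbabilityMeasure μ] {g : ℝ → ℝ} (hg : Measurable g)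
    (h : ∀ s ∈ Ioo (0 : ℝ) 1, g s = quantile μ s) : unif.map g = μ := by
  refine Measure.ext_of_Iic _ _ fun y => ?_
  have hc0 := cdf_nonneg μ y
  have hc1 := cdf_le_one μ y
  rw [Measure.map_apply hg measurableSet_Iic, unif,
    Measure.restrict_apply (hg measurableSet_Iic), ← ofReal_cdf]
  have h1 : g ⁻¹' Iic y ∩ Ioo 0 1 = Iic (cdf μ y) ∩ Ioo 0 1 := by
    ext s
    simp only [mem_inter_iff, mem_preimage, mem_Iic, and_congr_left_iff]
    intro hs
    rw [h s hs, quantile_le_iff μ hs]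
  -- The a.e. equal half-open interval avoids a separate case when the cdf equals 1.
  have h2 : Iic (cdf μ y) ∩ Ioc 0 1 = Ioc 0 (cdf μ y) := by
    ext s
    simp only [mem_inter_iff, mem_Iic, mem_Ioc]
    constructor <;> intro h <;> refine ⟨?_, ?_⟩ <;> grind
  rw [h1, measure_congr ((ae_eq_refl _).inter Ioo_ae_eq_Ioc), h2]
  simp

/-- A jointly measurable version of the quantile functions of a Markov kernel. -/
theorem exists_measurable_quantile {A : Type*} [MeasurableSpace A] (κ : Kernel A ℝ)
    [IsMarkovKernel κ] : ∃ q : A → ℝ → ℝ, Measurable (Function.uncurry q) ∧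
      (∀ a, MonotoneOn (q a) (Ioo 0 1)) ∧ ∀ a, unif.map (q a) = κ a := by
  classical
  let q : A → ℝ → ℝ := fun a s => if s ∈ Ioo (0 : ℝ) 1 then quantile (κ a) s else 0
  have hq : ∀ a, ∀ s ∈ Ioo (0 : ℝ) 1, q a s = quantile (κ a) s := fun a s hs => if_pos hs
  have hm : Measurable (Function.uncurry q) := by
    refine measurable_of_Iic fun y => ?_
    -- The Galois connection replaces the infimum by an inequality on the cdf, whose measurability
    -- in the parameter is that of the kernel.
    have : Function.uncurry q ⁻¹' Iic y =
        {x | x.2 ∈ Ioo (0 : ℝ) 1 ∧ x.2 ≤ (κ x.1).real (Iic y)} ∪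
          {x | x.2 ∉ Ioo (0 : ℝ) 1 ∧ 0 ≤ y} := by
      ext ⟨a, s⟩
      by_cases hs : s ∈ Ioo (0 : ℝ) 1
      · simp only [mem_preimage, Function.uncurry_apply_pair, mem_Iic, hq a s hs,
          quantile_le_iff _ hs, cdf_eq_real, mem_union, mem_ofPred_eq, hs]
        simp
      · have hq0 : q a s = 0 := if_neg hs
        simp only [mem_preimage, Function.uncurry_apply_pair, mem_Iic, hq0, mem_union,
          mem_ofPred_eq, hs]
        simp
    rw [this]
    have h2 : Measurable fun x : A × ℝ => x.2 := measurable_snd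
    have h3 : Measurable fun x : A × ℝ => (κ x.1).real (Iic y) := by
      have := κ.measurable_coe (s := Iic y) measurableSet_Iic
      simp_rw [measureReal_def]
      fun_prop
    exact ((h2 measurableSet_Ioo).inter (measurableSet_le h2 h3)).union
      ((h2 measurableSet_Ioo).compl.inter (MeasurableSet.const _))
  refine ⟨q, hm, fun a => ?_, fun a => unif_map_eq _ hm.of_uncurry_left (hq a)⟩
  exact (quantile_monotoneOn (κ a)).congr fun s hs => (hq a s hs).symm

/-! ### Prefixes of a uniform vector and the triangular transport. -/

theorem map_comp_pi {ι ι' : Type*} [Fintype ι] [Fintype ι'] (e : ι' → ι)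
    (he : Function.Injective e) :
    (Measure.pi fun _ : ι => unif).map (fun x i => x (e i)) = Measure.pi fun _ : ι' => unif := by
  have h := (iIndepFun_pi (μ := fun _ : ι => unif) (X := fun _ => id)
    fun _ => aemeasurable_id).precomp he
  simp only [id] at h
  rw [iIndepFun_iff_map_fun_eq_pi_map
    (fun i => (measurable_pi_apply (e i)).aemeasurable)] at h
  rw [h]
  congr with i : 1
  exact (measurePreserving_eval (fun _ : ι => unif) (e i)).map_eq

theorem map_init_last_cube (k : ℕ) :
    (cube (k + 1)).map (fun x => (Fin.init x, x (Fin.last k))) = (cube k).prod unif := by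
  have h := (measurePreserving_piFinSuccAbove (fun _ : Fin (k + 1) => unif) (Fin.last k)).map_eq
  have h' := congrArg (Measure.map Prod.swap) h
  rw [Measure.map_map measurable_swap (MeasurableEquiv.measurable _), Measure.prod_swap] at h'
  rw [cube, cube, ← h']
  congr 1
  ext x : 1
  simp [MeasurableEquiv.piFinSuccAbove, Fin.insertNthEquiv]

theorem measurable_prefixOf {m : ℕ} (t : Fin m) : Measurable fun x => prefixOf x t := by
  unfold prefixOf
  fun_prop

theorem map_prefixOf_cube {m : ℕ} (t : Fin m) :
    (cube m).map (fun x => (prefixOf x t, x t)) = (cube t).prod unif := by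
  have h := map_comp_pi (Fin.castLE (show (t : ℕ) + 1 ≤ m from t.isLt))
    (Fin.castLE_injective _)
  rw [← map_init_last_cube, cube, cube, ← h,
    Measure.map_map (by unfold Fin.init; fun_prop) (by fun_prop)]
  rfl

/-- By induction, transport the first `m` coordinates to their marginal, then feed the last uniform
variable to the quantile function of the conditional law given the transported point. Composing that
quantile with `T₀` expresses it through the prefix of the input `x`. -/
theorem exists_triangular_map (m : ℕ) (ν : Measure (Fin m → ℝ)) [IsProbabilityMeasure ν] :
    ∃ T : (Fin m → ℝ) → (Fin m → ℝ), Measurable T ∧ (cube m).map T = ν ∧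
      ∀ t : Fin m, ∃ q : (Fin (t : ℕ) → ℝ) → ℝ → ℝ, Measurable (Function.uncurry q) ∧
        (∀ z, MonotoneOn (q z) (Ioo 0 1)) ∧ ∀ x, T x t = q (prefixOf x t) (x t) := by
  induction m with
  | zero =>
    refine ⟨id, measurable_id, ?_, fun t => t.elim0⟩
    rw [Measure.map_id]
    ext s -
    rcases Subsingleton.eq_empty_or_singleton (s := s) subsingleton_of_subsingleton with rfl | ⟨x, rfl⟩
    · simp
    · have : ({x} : Set (Fin 0 → ℝ)) = univ := Subsingleton.eq_univ_of_nonempty ⟨x, rfl⟩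
      rw [this]; simp
  | succ m ih =>
    let e : (Fin (m + 1) → ℝ) → (Fin m → ℝ) × ℝ := fun y => (Fin.init y, y (Fin.last m))
    let e' : (Fin m → ℝ) × ℝ → (Fin (m + 1) → ℝ) := fun p => Fin.snoc (α := fun _ => ℝ) p.1 p.2
    have he : Measurable e := by unfold e Fin.init; fun_prop
    have he' : Measurable e' := by
      refine measurable_pi_iff.2 fun i => ?_
      induction i using Fin.lastCases with
      | last => simpa [e'] using measurable_snd
      | cast i => simpa [e', Function.comp_def] using (measurable_pi_apply i).comp measurable_fst
    have hee : ∀ y, e' (e y) = y := fun y => Fin.snoc_init_self y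
    let ν₁ := ν.map e
    have : IsProbabilityMeasure ν₁ := Measure.isProbabilityMeasure_map he.aemeasurable
    obtain ⟨T₀, hT₀, hT₀ν, hT₀q⟩ := ih ν₁.fst
    obtain ⟨q, hq, hqm, hqκ⟩ := exists_measurable_quantile ν₁.condKernel
    let T₁ : (Fin m → ℝ) × ℝ → (Fin m → ℝ) × ℝ := fun p => (T₀ p.1, q (T₀ p.1) p.2)
    have hqT : Measurable fun p : (Fin m → ℝ) × ℝ => q (T₀ p.1) p.2 :=
      hq.comp ((hT₀.comp measurable_fst).prodMk measurable_snd)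
    have hT₁ : Measurable T₁ := (hT₀.comp measurable_fst).prodMk hqT
    have hmap : ((cube m).prod unif).map T₁ = ν₁ := by
      refine Eq.trans ?_ (ν₁.disintegrate ν₁.condKernel)
      ext s hs
      rw [Measure.map_apply hT₁ hs, Measure.prod_apply (hT₁ hs), Measure.compProd_apply hs,
        ← hT₀ν, lintegral_map (Kernel.measurable_kernel_prodMk_left hs) hT₀]
      refine lintegral_congr fun z => ?_
      rw [← hqκ, Measure.map_apply hq.of_uncurry_left (measurable_prodMk_left hs)]
      rfl
    refine ⟨fun x => e' (T₁ (e x)), he'.comp (hT₁.comp he), ?_, fun t => ?_⟩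
    · have h1 : (fun x => e' (T₁ (e x))) = e' ∘ (T₁ ∘ e) := rfl
      rw [h1, ← Measure.map_map he' (hT₁.comp he), ← Measure.map_map hT₁ he,
        map_init_last_cube, hmap, Measure.map_map he' he]
      have : e' ∘ e = id := funext hee
      rw [this, Measure.map_id]
    · induction t using Fin.lastCases with
      | last =>
        refine ⟨fun z s => q (T₀ z) s, hqT, fun z => hqm _, fun x => ?_⟩
        simp only [e', Fin.snoc_last]
        rfl
      | cast i =>
        obtain ⟨r, hr, hrm, hrT⟩ := hT₀q i
        refine ⟨r, hr, hrm, fun x => ?_⟩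
        simp only [e', Fin.snoc_castSucc]
        exact hrT _

/-! ### Universal approximation by one-hidden-layer networks. -/

theorem exists_dotProduct_of_strongDual {k : ℕ} (L : StrongDual ℝ (Fin k → ℝ)) :
    ∃ a : Fin k → ℝ, ∀ z, L z = a ⬝ᵥ z := by
  refine ⟨fun i => L (Pi.single i 1), fun z => ?_⟩
  have := LinearMap.pi_apply_eq_sum_univ L.toLinearMap z
  simp only [ContinuousLinearMap.coe_coe, smul_eq_mul] at this
  rw [this, dotProduct]
  refine Finset.sum_congr rfl fun i _ => ?_
  rw [mul_comm]
  congr 2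
  ext j
  simp [Pi.single_apply, eq_comm]

/-- A finite Borel measure on `ℝ^k` is determined by its values on half-spaces. -/
theorem measure_eq_of_halfSpaces {k : ℕ} {μ ν : Measure (Fin k → ℝ)} [IsFiniteMeasure μ]
    [IsFiniteMeasure ν] (h : ∀ (a : Fin k → ℝ) (c : ℝ), μ {z | a ⬝ᵥ z ≤ c} = ν {z | a ⬝ᵥ z ≤ c}) :
    μ = ν := by
  refine Measure.ext_of_charFunDual ?_
  ext L
  obtain ⟨a, ha⟩ := exists_dotProduct_of_strongDual L
  rw [charFunDual_eq_charFun_map_one, charFunDual_eq_charFun_map_one]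
  congr 1
  refine Measure.ext_of_Iic _ _ fun c => ?_
  rw [Measure.map_apply L.continuous.measurable measurableSet_Iic,
    Measure.map_apply L.continuous.measurable measurableSet_Iic]
  simpa [preimage, ha] using h a c

/-- The shift `-n` sends the argument to `-∞` even at `x = 0`, while `n²` overcomes it for `x > 0`.
The limit is thus an exact half-line indicator, whatever the value of `φ 0`. -/
theorem IsSigmoidal.tendsto_scaled {φ : ℝ → ℝ} (hφ : IsSigmoidal φ) (x : ℝ) :
    Tendsto (fun n : ℕ => φ ((n : ℝ) ^ 2 * x - n)) atTop (𝓝 (if 0 < x then 1 else 0)) := by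
  have hn : Tendsto (fun n : ℕ => (n : ℝ)) atTop atTop := tendsto_natCast_atTop_atTop
  split_ifs with hx
  · refine hφ.tendsto_atTop.comp ?_
    have h1 : Tendsto (fun n : ℕ => (n : ℝ) * x - 1) atTop atTop :=
      tendsto_atTop_add_const_right _ _ (hn.atTop_mul_const hx)
    refine (hn.atTop_mul_atTop₀ h1).congr fun n => by ring
  · refine hφ.tendsto_atBot.comp ?_
    refine tendsto_atBot_mono (fun n => ?_) (tendsto_neg_atTop_atBot.comp hn)
    have : (n : ℝ) ^ 2 * x ≤ 0 := mul_nonpos_of_nonneg_of_nonpos (sq_nonneg _) (not_lt.1 hx)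
    simp only [Function.comp]
    linarith

variable {φ : ℝ → ℝ}

/-- A hidden unit, as a function on the input space. -/
def hiddenUnit (φ : ℝ → ℝ) {k : ℕ} (p : (Fin k → ℝ) × ℝ) (z : Fin k → ℝ) : ℝ :=
  φ (p.1 ⬝ᵥ z + p.2)

theorem continuous_hiddenUnit (hφ : Continuous φ) {k : ℕ} (p : (Fin k → ℝ) × ℝ) :
    Continuous (hiddenUnit φ p) := by
  unfold hiddenUnit dotProduct
  fun_prop

/-- Continuous sigmoidal functions are discriminatory. -/
theorem ae_eq_zero_of_integral_hiddenUnit (hφ : IsSigmoidal φ) {k : ℕ} {ρ : Measure (Fin k → ℝ)}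
    [IsFiniteMeasure ρ] {h : (Fin k → ℝ) → ℝ} (hh : Integrable h ρ)
    (h0 : ∀ p, ∫ z, h z * hiddenUnit φ p z ∂ρ = 0) : h =ᵐ[ρ] 0 := by
  obtain ⟨M, hM⟩ := hφ.bounded
  have hdot : ∀ a : Fin k → ℝ, Measurable fun z : Fin k → ℝ => a ⬝ᵥ z := fun a => by
    unfold dotProduct; fun_prop
  have hS : ∀ (a : Fin k → ℝ) c, MeasurableSet {z : Fin k → ℝ | 0 < a ⬝ᵥ z + c} := fun a c =>
    measurableSet_lt measurable_const ((hdot a).add_const c)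
  have hpos : ∀ (a : Fin k → ℝ) c, ∫ z in {z | 0 < a ⬝ᵥ z + c}, h z ∂ρ = 0 := by
    intro a c
    have key := tendsto_integral_of_dominated_convergence (μ := ρ)
      (F := fun (n : ℕ) z => h z * hiddenUnit φ ((n : ℝ) ^ 2 • a, (n : ℝ) ^ 2 * c - n) z)
      (f := fun z => h z * if 0 < a ⬝ᵥ z + c then 1 else 0) (fun z => |h z| * M)
      (fun n => hh.aestronglyMeasurable.mul
        (continuous_hiddenUnit hφ.continuous _).aestronglyMeasurable)
      (hh.abs.mul_const M)
      (fun n => ae_of_all _ fun z => by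
        rw [Real.norm_eq_abs, abs_mul]
        exact mul_le_mul_of_nonneg_left (hM _) (abs_nonneg _))
      (ae_of_all _ fun z => by
        refine Tendsto.const_mul _ ((hφ.tendsto_scaled (a ⬝ᵥ z + c)).congr fun n => ?_)
        rw [hiddenUnit, smul_dotProduct, smul_eq_mul]
        ring_nf)
    simp only [h0] at key
    rw [← integral_indicator (hS a c)]
    refine Eq.trans ?_ (tendsto_nhds_unique key tendsto_const_nhds)
    refine integral_congr_ae (ae_of_all _ fun z => ?_)
    by_cases hz : 0 < a ⬝ᵥ z + c <;> simp [indicator, hz]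
  have htot : ∫ z, h z ∂ρ = 0 := by simpa using hpos 0 1
  have hle : ∀ (a : Fin k → ℝ) c, ∫ z in {z | a ⬝ᵥ z ≤ c}, h z ∂ρ = 0 := by
    intro a c
    have h1 := integral_add_compl (hS a (-c)) hh
    rw [hpos, htot, zero_add] at h1
    convert h1 using 3
    ext z
    simp
  have hf1 := isFiniteMeasure_withDensity_ofReal hh.2
  have hf2 := isFiniteMeasure_withDensity_ofReal hh.neg.2
  -- The positive and negative parts of `h` define finite measures that agree on all half-spaces,
  -- hence coincide.
  have heq : ρ.withDensity (fun z => ENNReal.ofReal (h z)) =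
      ρ.withDensity fun z => ENNReal.ofReal ((-h) z) := by
    refine measure_eq_of_halfSpaces fun a c => ?_
    have hm : MeasurableSet {z : Fin k → ℝ | a ⬝ᵥ z ≤ c} :=
      measurableSet_le (hdot a) measurable_const
    have h1 := integral_eq_lintegral_pos_part_sub_lintegral_neg_part
      (hh.restrict (s := {z | a ⬝ᵥ z ≤ c}))
    rw [hle, ← withDensity_apply _ hm, ← withDensity_apply _ hm] at h1
    exact (ENNReal.toReal_eq_toReal_iff' (measure_ne_top _ _) (measure_ne_top _ _)).1
      (sub_eq_zero.1 h1.symm)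
  rw [withDensity_eq_iff hh.1.aemeasurable.ennreal_ofReal hh.neg.1.aemeasurable.ennreal_ofReal
    hh.lintegral_lt_top.ne] at heq
  filter_upwards [heq] with z hz
  rcases le_total 0 (h z) with hz0 | hz0
  · rw [ENNReal.ofReal_of_nonpos (p := (-h) z) (by simpa using hz0),
      ENNReal.ofReal_eq_zero] at hz
    exact le_antisymm hz hz0
  · rw [ENNReal.ofReal_of_nonpos hz0, eq_comm, ENNReal.ofReal_eq_zero] at hz
    exact le_antisymm hz0 (by simpa using hz)

/-- The scalar functions computed by one-hidden-layer networks. -/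
def networkSpan (φ : ℝ → ℝ) (k : ℕ) : Submodule ℝ ((Fin k → ℝ) → ℝ) :=
  Submodule.span ℝ (range (hiddenUnit φ))

/-- **Universal approximation**: bounded measurable functions are limits almost everywhere of
one-hidden-layer networks. -/
theorem exists_tendsto_networkSpan (hφ : IsSigmoidal φ) {k : ℕ} (ρ : Measure (Fin k → ℝ))
    [IsFiniteMeasure ρ] {u : (Fin k → ℝ) → ℝ} (hu : Measurable u) {C : ℝ} (hC : ∀ z, |u z| ≤ C) :
    ∃ g : ℕ → (Fin k → ℝ) → ℝ, (∀ i, g i ∈ networkSpan φ k) ∧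
      ∀ᵐ z ∂ρ, Tendsto (fun i => g i z) atTop (𝓝 (u z)) := by
  obtain ⟨M, hM⟩ := hφ.bounded
  have hLp : ∀ p : (Fin k → ℝ) × ℝ, MemLp (hiddenUnit φ p) 2 ρ := fun p =>
    MemLp.of_bound (continuous_hiddenUnit hφ.continuous p).aestronglyMeasurable M
      (ae_of_all _ fun z => hM _)
  have huLp : MemLp u 2 ρ := MemLp.of_bound hu.aestronglyMeasurable C (ae_of_all _ hC)
  let V : Submodule ℝ (Lp ℝ 2 ρ) := Submodule.span ℝ (range fun p => (hLp p).toLp)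
  -- Density in `L²`: a function orthogonal to every hidden unit vanishes by the discriminatory
  -- property.
  have hV : V.topologicalClosure = ⊤ := by
    rw [Submodule.topologicalClosure_eq_top_iff, Submodule.eq_bot_iff]
    intro h hh
    rw [Lp.eq_zero_iff_ae_eq_zero]
    refine ae_eq_zero_of_integral_hiddenUnit hφ ((Lp.memLp h).integrable one_le_two) fun p => ?_
    have h1 := (Submodule.mem_orthogonal _ _).1 hh _ (Submodule.subset_span ⟨p, rfl⟩)
    rw [L2.inner_def] at h1
    rw [← h1]
    refine integral_congr_ae ?_
    filter_upwards [(hLp p).coeFn_toLp] with z hz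
    simp [hz]
  have hVg : ∀ x ∈ V, ∃ g ∈ networkSpan φ k, x =ᵐ[ρ] g := by
    intro x hx
    induction hx using Submodule.span_induction with
    | mem x hx =>
      obtain ⟨p, rfl⟩ := hx
      exact ⟨_, Submodule.subset_span ⟨p, rfl⟩, (hLp p).coeFn_toLp⟩
    | zero => exact ⟨0, Submodule.zero_mem _, Lp.coeFn_zero _ _ _⟩
    | add x y _ _ hx hy =>
      obtain ⟨g, hg, hxg⟩ := hx
      obtain ⟨g', hg', hyg⟩ := hy
      exact ⟨g + g', Submodule.add_mem _ hg hg', (Lp.coeFn_add _ _).trans (hxg.add hyg)⟩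
    | smul a x _ hx =>
      obtain ⟨g, hg, hxg⟩ := hx
      exact ⟨a • g, Submodule.smul_mem _ _ hg, (Lp.coeFn_smul _ _).trans (hxg.const_smul a)⟩
  have hmem : huLp.toLp ∈ closure (V : Set (Lp ℝ 2 ρ)) := by
    rw [← Submodule.topologicalClosure_coe, hV]
    trivial
  obtain ⟨x, hxV, hx⟩ := mem_closure_iff_seq_limit.1 hmem
  obtain ⟨ns, -, hns⟩ := (tendstoInMeasure_of_tendsto_Lp hx).exists_seq_tendsto_ae
  choose g hg hxg using fun i => hVg (x i) (hxV i)
  refine ⟨fun i => g (ns i), fun i => hg _, ?_⟩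
  filter_upwards [hns, huLp.coeFn_toLp, ae_all_iff.2 hxg] with z h1 h2 h3
  simpa [h2, h3] using h1

/-- Finitely many scalar networks can be assembled into one network. -/
theorem exists_mlp_eval_eq {k q : ℕ} {g : Fin q → (Fin k → ℝ) → ℝ}
    (hg : ∀ j, g j ∈ networkSpan φ k) : ∃ N : MLP k q, ∀ z j, N.eval φ z j = g j z := by
  classical
  choose c hc using fun j => Finsupp.mem_span_range_iff_exists_finsupp.1 (hg j)
  -- The union of the supports serves as a common hidden layer.
  let F : Finset ((Fin k → ℝ) × ℝ) := Finset.univ.biUnion fun j => (c j).support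
  let e := F.equivFin.symm
  refine ⟨⟨F.card, fun h => (e h).1.1, fun h => (e h).1.2, fun j h => c j (e h), 0⟩,
    fun z j => ?_⟩
  have h1 : g j = ∑ p ∈ F, c j p • hiddenUnit φ p := by
    rw [← hc j]
    exact Finsupp.sum_of_support_subset _
      (Finset.subset_biUnion_of_mem (fun j => (c j).support) (Finset.mem_univ j)) _ (by simp)
  rw [h1, ← Finset.sum_coe_sort, ← e.sum_comp]
  simp [MLP.eval, Matrix.mulVec, dotProduct, hiddenUnit]

theorem exists_tendsto_mlp (hφ : IsSigmoidal φ) {k q : ℕ} (ρ : Measure (Fin k → ℝ))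
    [IsFiniteMeasure ρ] {u : (Fin k → ℝ) → Fin q → ℝ} (hu : Measurable u) {C : ℝ}
    (hC : ∀ z j, |u z j| ≤ C) :
    ∃ N : ℕ → MLP k q, ∀ᵐ z ∂ρ, Tendsto (fun i => (N i).eval φ z) atTop (𝓝 (u z)) := by
  choose g hg hgu using fun j => exists_tendsto_networkSpan hφ ρ
    (u := fun z => u z j) (by fun_prop) (fun z => hC z j)
  choose N hN using fun i => exists_mlp_eval_eq (φ := φ) fun j => hg j i
  refine ⟨N, ?_⟩
  filter_upwards [ae_all_iff.2 hgu] with z hz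
  refine tendsto_pi_nhds.2 fun j => ?_
  simpa [hN] using hz j

theorem MLP.measurable_eval (hφ : Continuous φ) {k q : ℕ} (N : MLP k q) :
    Measurable (N.eval φ) := by
  refine Continuous.measurable ?_
  unfold MLP.eval
  fun_prop

/-- The network with a constant output. -/
def MLP.const (k : ℕ) {q : ℕ} (c : Fin q → ℝ) : MLP k q := ⟨0, 0, 0, 0, c⟩

@[simp]
theorem MLP.eval_const (k : ℕ) {q : ℕ} (c : Fin q → ℝ) (z : Fin k → ℝ) :
    (MLP.const k c).eval φ z = c := by
  ext j
  simp [MLP.eval, MLP.const, Matrix.mulVec, dotProduct]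

/-! ### Mixtures of sigmoids and their limits. -/

theorem continuous_softmax {n : ℕ} : Continuous (softmax (n := n + 1)) := by
  refine continuous_pi fun j => ?_
  unfold softmax
  refine Continuous.div (by fun_prop) (by fun_prop) fun u => ?_
  exact (Finset.sum_pos (fun _ _ => Real.exp_pos _) Finset.univ_nonempty).ne'

theorem softmax_nonneg {n : ℕ} (u : Fin n → ℝ) (j : Fin n) : 0 ≤ softmax u j :=
  div_nonneg (Real.exp_pos _).le (Finset.sum_nonneg fun _ _ => (Real.exp_pos _).le)

theorem sum_softmax {n : ℕ} (u : Fin (n + 1) → ℝ) : ∑ j, softmax u j = 1 := by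
  simp only [softmax]
  rw [← Finset.sum_div]
  exact div_self (Finset.sum_pos (fun _ _ => Real.exp_pos _) Finset.univ_nonempty).ne'

theorem softmax_log {n : ℕ} {w : Fin n → ℝ} (hw : ∀ j, 0 < w j) (h1 : ∑ j, w j = 1) :
    softmax (fun j => Real.log (w j)) = w := by
  ext j
  simp [softmax, Real.exp_log (hw _), h1]

theorem abs_sum_mul_le_one {n : ℕ} {w v : Fin n → ℝ} (hw : ∀ j, 0 ≤ w j) (h1 : ∑ j, w j = 1)
    (hv : ∀ j, |v j| ≤ 1) : |∑ j, w j * v j| ≤ 1 := by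
  rw [← h1]
  refine (Finset.abs_sum_le_sum_abs _ _).trans (Finset.sum_le_sum fun j _ => ?_)
  rw [abs_mul, abs_of_nonneg (hw j)]
  exact mul_le_of_le_one_right (hw j) (hv j)

theorem abs_sigmoid_le_one (x : ℝ) : |Real.sigmoid x| ≤ 1 := by
  rw [abs_of_pos (Real.sigmoid_pos x)]
  exact Real.sigmoid_le_one x

/-- The mixture of sigmoids with given preactivations of weights, biases and scales. -/
noncomputable def mixture {n : ℕ} (u b τ : Fin n → ℝ) (s : ℝ) : ℝ :=
  ∑ j, softmax u j * Real.sigmoid ((s - Real.sigmoid (b j)) / Real.exp (τ j))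

/-- The conditional mixture of sigmoids whose parameters are given by networks. -/
noncomputable def netMixture (φ : ℝ → ℝ) {k n : ℕ} (Nw Nb Nτ : MLP k n) (p : (Fin k → ℝ) × ℝ) :
    ℝ :=
  mixture (Nw.eval φ p.1) (Nb.eval φ p.1) (Nτ.eval φ p.1) p.2

theorem measurable_netMixture (hφ : Continuous φ) {k n : ℕ} (Nw Nb Nτ : MLP k (n + 1)) :
    Measurable (netMixture φ Nw Nb Nτ) := by
  have hw := Nw.measurable_eval hφ
  have hb := Nb.measurable_eval hφ
  have hτ := Nτ.measurable_eval hφ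
  have hs : Measurable (softmax (n := n + 1)) := continuous_softmax.measurable
  have hsig : Measurable Real.sigmoid := continuous_sigmoid.measurable
  unfold netMixture mixture
  fun_prop

/-- Functions of `(x_{1:t-1}, x_t)` that are `L¹`-limits of network-conditioned mixtures of
sigmoids. -/
def IsMixtureLimit (φ : ℝ → ℝ) {k : ℕ} (g : (Fin k → ℝ) × ℝ → ℝ) : Prop :=
  ∀ ε : ENNReal, 0 < ε → ∃ (n : ℕ) (Nw Nb Nτ : MLP k (n + 1)),
    ∫⁻ p, ‖netMixture φ Nw Nb Nτ p - g p‖ₑ ∂(cube k).prod unif < ε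

/-- Dominated convergence with bound 2 gives `L¹` convergence, and `L¹` limits of `L¹` limits are
again such limits. -/
theorem IsMixtureLimit.of_tendsto {k : ℕ} {g : ℕ → (Fin k → ℝ) × ℝ → ℝ}
    {g₀ : (Fin k → ℝ) × ℝ → ℝ} (hg : ∀ i, IsMixtureLimit φ (g i)) (hgm : ∀ i, Measurable (g i))
    (hg1 : ∀ i p, |g i p| ≤ 1)
    (hlim : ∀ᵐ p ∂(cube k).prod unif, Tendsto (fun i => g i p) atTop (𝓝 (g₀ p))) :
    IsMixtureLimit φ g₀ := by
  intro ε hε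
  have hg₀m : AEMeasurable g₀ ((cube k).prod unif) :=
    aemeasurable_of_tendsto_metrizable_ae atTop (fun i => (hgm i).aemeasurable) hlim
  have hL : Tendsto (fun i => ∫⁻ p, ‖g i p - g₀ p‖ₑ ∂(cube k).prod unif) atTop (𝓝 0) := by
    have := tendsto_lintegral_of_dominated_convergence' (μ := (cube k).prod unif)
      (F := fun i p => ‖g i p - g₀ p‖ₑ) (f := fun _ => 0) (fun _ => ENNReal.ofReal 2)
      (fun i => ((hgm i).aemeasurable.sub hg₀m).enorm)
      (fun i => by
        filter_upwards [hlim] with p hp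
        have h0 : |g₀ p| ≤ 1 := le_of_tendsto hp.abs (Eventually.of_forall fun i => hg1 i p)
        rw [Real.enorm_eq_ofReal_abs]
        refine ENNReal.ofReal_le_ofReal ((abs_sub _ _).trans ?_)
        linarith [hg1 i p])
      (by simp)
      (by
        filter_upwards [hlim] with p hp
        have h1 := (hp.sub_const (g₀ p)).enorm
        simpa using h1)
    simpa using this
  have hε2 : 0 < ε / 2 := ENNReal.half_pos hε.ne'
  obtain ⟨i, hi⟩ := (hL.eventually (gt_mem_nhds hε2)).exists
  obtain ⟨n, Nw, Nb, Nτ, hN⟩ := hg i (ε / 2) hε2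
  refine ⟨n, Nw, Nb, Nτ, ?_⟩
  calc _ ≤ ∫⁻ p, (‖netMixture φ Nw Nb Nτ p - g i p‖ₑ + ‖g i p - g₀ p‖ₑ) ∂(cube k).prod unif := by
        refine lintegral_mono fun p => ?_
        rw [← sub_add_sub_cancel (netMixture φ Nw Nb Nτ p) (g i p) (g₀ p)]
        exact enorm_add_le _ _
    _ = _ + _ := lintegral_add_right' _ ((hgm i).aemeasurable.sub hg₀m).enorm
    _ < ε / 2 + ε / 2 := ENNReal.add_lt_add hN hi
    _ = ε := ENNReal.add_halves ε

theorem isMixtureLimit_netMixture {k n : ℕ} (Nw Nb Nτ : MLP k (n + 1)) :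
    IsMixtureLimit φ (netMixture φ Nw Nb Nτ) :=
  fun ε hε => ⟨n, Nw, Nb, Nτ, by simpa using hε⟩

theorem isMixtureLimit_softmax (hφ : IsSigmoidal φ) {k n : ℕ} {u : (Fin k → ℝ) → Fin (n + 1) → ℝ}
    (hu : Measurable u) {C : ℝ} (hC : ∀ z j, |u z j| ≤ C) {b : Fin (n + 1) → ℝ}
    (hb : ∀ j, b j ∈ Ioo (0 : ℝ) 1) {τ : ℝ} (hτ : 0 < τ) :
    IsMixtureLimit φ fun p : (Fin k → ℝ) × ℝ =>
      ∑ j, softmax (u p.1) j * Real.sigmoid ((p.2 - b j) / τ) := by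
  obtain ⟨N, hN⟩ := exists_tendsto_mlp hφ (cube k) hu hC
  let Nb := MLP.const k fun j => logit (b j)
  let Nτ := MLP.const k fun _ : Fin (n + 1) => Real.log τ
  refine IsMixtureLimit.of_tendsto (fun i => isMixtureLimit_netMixture (N i) Nb Nτ)
    (fun i => measurable_netMixture hφ.continuous _ _ _)
    (fun i p => abs_sum_mul_le_one (softmax_nonneg _) (sum_softmax _)
      fun j => abs_sigmoid_le_one _) ?_
  filter_upwards [Measure.quasiMeasurePreserving_fst.ae hN] with p hp
  have h1 := (continuous_softmax.tendsto _).comp hp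
  simp only [netMixture, mixture, Nb, Nτ, MLP.eval_const, sigmoid_logit (hb _), Real.exp_log hτ]
  exact tendsto_finsetSum _ fun j _ => ((tendsto_pi_nhds.1 h1) j).mul_const _

/-- The logarithms of the weights are softmax preactivations, and the lower bound `δ` keeps them
bounded, as universal approximation requires. -/
theorem isMixtureLimit_pos_weights (hφ : IsSigmoidal φ) {k n : ℕ}
    {w : (Fin k → ℝ) → Fin (n + 1) → ℝ} (hw : Measurable w) {δ : ℝ} (hδ : 0 < δ)
    (hwδ : ∀ z j, δ ≤ w z j) (hw1 : ∀ z, ∑ j, w z j = 1) {b : Fin (n + 1) → ℝ}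
    (hb : ∀ j, b j ∈ Ioo (0 : ℝ) 1) {τ : ℝ} (hτ : 0 < τ) :
    IsMixtureLimit φ fun p : (Fin k → ℝ) × ℝ =>
      ∑ j, w p.1 j * Real.sigmoid ((p.2 - b j) / τ) := by
  have hpos : ∀ z j, 0 < w z j := fun z j => hδ.trans_le (hwδ z j)
  have h := isMixtureLimit_softmax hφ (u := fun z j => Real.log (w z j)) (by fun_prop)
    (C := -Real.log δ) (fun z j => ?_) hb hτ
  · simpa only [softmax_log (hpos _) (hw1 _)] using h
  · have hle : w z j ≤ 1 := by
      rw [← hw1 z]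
      exact Finset.single_le_sum (fun i _ => (hpos z i).le) (Finset.mem_univ j)
    rw [abs_of_nonpos (Real.log_nonpos (hpos z j).le hle)]
    exact neg_le_neg (Real.log_le_log hδ (hwδ z j))

theorem tendsto_sigmoid_scaled {x : ℝ} (hx : x ≠ 0) :
    Tendsto (fun i : ℕ => Real.sigmoid (x / (1 / ((i : ℝ) + 1)))) atTop
      (𝓝 (if 0 < x then 1 else 0)) := by
  have hi : Tendsto (fun i : ℕ => (i : ℝ) + 1) atTop atTop :=
    tendsto_atTop_add_const_right _ _ tendsto_natCast_atTop_atTop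
  simp only [div_div_eq_mul_div, div_one]
  split_ifs with h
  · exact Real.tendsto_sigmoid_atTop.comp (hi.const_mul_atTop h)
  · exact Real.tendsto_sigmoid_atBot.comp
      (hi.const_mul_atTop_of_neg (lt_of_le_of_ne (not_lt.1 h) hx))

/-- Weights are pushed away from 0 by adding `δ i` and renormalising by `D i`. The same `δ i` is the
scale of the sigmoids, which converge to steps off the finitely many points `b j`. -/
theorem isMixtureLimit_steps (hφ : IsSigmoidal φ) {k n : ℕ}
    {w : (Fin k → ℝ) → Fin (n + 1) → ℝ} (hw : Measurable w)
    (hw0 : ∀ z j, 0 ≤ w z j) (hw1 : ∀ z, ∑ j, w z j = 1) {b : Fin (n + 1) → ℝ}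
    (hb : ∀ j, b j ∈ Ioo (0 : ℝ) 1) :
    IsMixtureLimit φ fun p : (Fin k → ℝ) × ℝ =>
      ∑ j, w p.1 j * if b j < p.2 then 1 else 0 := by
  let δ : ℕ → ℝ := fun i => 1 / ((i : ℝ) + 1)
  have hδ : ∀ i, 0 < δ i := fun i => Nat.one_div_pos_of_nat
  have hδ0 : Tendsto δ atTop (𝓝 0) := tendsto_one_div_add_atTop_nhds_zero_nat
  let D : ℕ → ℝ := fun i => 1 + ((n : ℝ) + 1) * δ i
  have hD : ∀ i, 0 < D i := fun i => by have := hδ i; positivity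
  have hD1 : Tendsto D atTop (𝓝 1) := by
    simpa [D] using (hδ0.const_mul ((n : ℝ) + 1)).const_add 1
  let v : ℕ → (Fin k → ℝ) → Fin (n + 1) → ℝ := fun i z j => (w z j + δ i) / D i
  have hvm : ∀ i, Measurable (v i) := fun i => by fun_prop
  have hv : ∀ i z j, δ i / D i ≤ v i z j := fun i z j => by
    have := hw0 z j
    have := hD i
    simp only [v]
    gcongr
    linarith
  have hv1 : ∀ i z, ∑ j, v i z j = 1 := fun i z => by
    simp only [v]
    rw [← Finset.sum_div, Finset.sum_add_distrib, hw1, Finset.sum_const, Finset.card_univ,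
      Fintype.card_fin, nsmul_eq_mul]
    push_cast
    exact div_self (hD i).ne'
  have hδD : ∀ i, 0 < δ i / D i := fun i => div_pos (hδ i) (hD i)
  have hsig : Measurable Real.sigmoid := continuous_sigmoid.measurable
  refine IsMixtureLimit.of_tendsto
    (fun i => isMixtureLimit_pos_weights hφ (hvm i) (hδD i) (hv i) (hv1 i) hb (hδ i))
    (fun i => by fun_prop)
    (fun i p => abs_sum_mul_le_one (fun j => ((hδD i).trans_le (hv i p.1 j)).le) (hv1 i p.1)
      fun j => abs_sigmoid_le_one _) ?_
  have hne : ∀ᵐ s ∂unif, ∀ j, s ≠ b j :=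
    ae_restrict_of_ae (ae_all_iff.2 fun j => Measure.ae_ne volume (b j))
  filter_upwards [Measure.quasiMeasurePreserving_snd.ae hne] with p hp
  refine tendsto_finsetSum _ fun j _ => Tendsto.mul ?_ ?_
  · simpa [v, Pi.div_def] using (hδ0.const_add (w p.1 j)).div hD1 one_ne_zero
  · simpa only [sub_pos] using tendsto_sigmoid_scaled (sub_ne_zero.2 (hp j))

/-- A step function built from the increments of a monotone function is squeezed between
translates of that function. -/
theorem step_mem_Icc {p : ℝ → ℝ} (hp : Monotone p) (hp0 : ∀ s, 0 ≤ p s) (hp1 : ∀ s, p s ≤ 1)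
    (h0 : p 0 = 0) (h1 : p 1 = 1) {h : ℝ} {n : ℕ} (hh : h * n = 1) (hpos : 0 < h) (s : ℝ) :
    ∑ j : Fin n, (p (((j : ℕ) + 1) * h) - p ((j : ℕ) * h)) *
      (if ((j : ℕ) + 1 / 2) * h < s then 1 else 0) ∈ Icc (p (s - h)) (p (s + h)) := by
  have tele : ∀ g : ℝ → ℝ, ∑ j : Fin n, (g (((j : ℕ) + 1) * h) - g ((j : ℕ) * h)) = g 1 - g 0 := by
    intro g
    rw [Fin.sum_univ_eq_sum_range (fun j : ℕ => g (((j : ℝ) + 1) * h) - g ((j : ℝ) * h)) n]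
    have := Finset.sum_range_sub (fun j : ℕ => g ((j : ℝ) * h)) n
    push_cast at this
    rw [this, mul_comm (n : ℝ), hh, zero_mul]
  have hmono : ∀ j : ℕ, p (j * h) ≤ p ((j + 1) * h) := fun j => hp (by nlinarith)
  constructor
  -- Truncation at `p (s - h)` does not enlarge increments and kills those of the inactive steps, so
  -- the telescoped total bounds the active sum from below. The upper bound is dual, with `max` and
  -- `p (s + h)`.
  · have := tele fun x => min (p x) (p (s - h))
    simp only [h0, h1, min_eq_right (hp1 _), min_eq_left (hp0 _), sub_zero] at this
    rw [← this]
    refine Finset.sum_le_sum fun j _ => ?_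
    have hj := hmono j
    split_ifs with hs
    · grind
    · have h2 : p (s - h) ≤ p ((j : ℕ) * h) := hp (by nlinarith)
      rw [min_eq_right h2, min_eq_right (h2.trans hj)]
      simp
  · have h3 := tele fun x => max (p x) (p (s + h))
    have h4 := tele p
    simp only [h0, h1, max_eq_left (hp1 _), max_eq_right (hp0 _), sub_zero] at h3 h4
    have h5 : ∑ j : Fin n, (max (p (((j : ℕ) + 1) * h)) (p (s + h)) -
        max (p ((j : ℕ) * h)) (p (s + h))) ≤
        ∑ j : Fin n, ((p (((j : ℕ) + 1) * h) - p ((j : ℕ) * h)) -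
          (p (((j : ℕ) + 1) * h) - p ((j : ℕ) * h)) *
            (if ((j : ℕ) + 1 / 2) * h < s then 1 else 0)) := by
      refine Finset.sum_le_sum fun j _ => ?_
      have hj := hmono j
      split_ifs with hs
      · have h2 : p (((j : ℕ) + 1) * h) ≤ p (s + h) := hp (by nlinarith)
        rw [max_eq_right h2, max_eq_right (hj.trans h2)]
        simp
      · grind
    rw [h3, Finset.sum_sub_distrib, h4] at h5
    linarith

/-- The grid step functions are squeezed between `p z (s - h)` and `p z (s + h)`, so they converge
wherever `p z` is continuous, that is, off a countable set for each `z`. -/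
theorem isMixtureLimit_monotone (hφ : IsSigmoidal φ) {k : ℕ} {p : (Fin k → ℝ) → ℝ → ℝ}
    (hpm : Measurable (Function.uncurry p)) (hp : ∀ z, Monotone (p z)) (hp0 : ∀ z s, 0 ≤ p z s)
    (hp1 : ∀ z s, p z s ≤ 1) (h0 : ∀ z, p z 0 = 0) (h1 : ∀ z, p z 1 = 1) :
    IsMixtureLimit φ (Function.uncurry p) := by
  let h : ℕ → ℝ := fun n => 1 / ((n : ℝ) + 1)
  have hpos : ∀ n, 0 < h n := fun n => Nat.one_div_pos_of_nat
  have hh : ∀ n, h n * ((n + 1 : ℕ) : ℝ) = 1 := fun n => by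
    simp only [h]; push_cast; field_simp
  have hlim : Tendsto h atTop (𝓝 0) := tendsto_one_div_add_atTop_nhds_zero_nat
  let w : (n : ℕ) → (Fin k → ℝ) → Fin (n + 1) → ℝ := fun n z j =>
    p z (((j : ℕ) + 1) * h n) - p z ((j : ℕ) * h n)
  -- Midpoints of the cells, unlike their endpoints, all lie strictly inside `(0,1)`.
  let b : (n : ℕ) → Fin (n + 1) → ℝ := fun n j => ((j : ℕ) + 1 / 2) * h n
  have hps : ∀ s, Measurable fun z => p z s := fun s => hpm.comp (measurable_id.prodMk measurable_const)
  have hwm : ∀ n, Measurable (w n) := fun n =>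
    measurable_pi_iff.2 fun j => (hps _).sub (hps _)
  have hw0 : ∀ n z j, 0 ≤ w n z j := fun n z j =>
    sub_nonneg.2 (hp z (by have := hpos n; nlinarith))
  have hw1 : ∀ n z, ∑ j, w n z j = 1 := fun n z => by
    simp only [w]
    rw [Fin.sum_univ_eq_sum_range
      (fun j : ℕ => p z (((j : ℝ) + 1) * h n) - p z ((j : ℝ) * h n)) (n + 1)]
    have := Finset.sum_range_sub (fun j : ℕ => p z ((j : ℝ) * h n)) (n + 1)
    rw [Nat.cast_zero, zero_mul, mul_comm ((n + 1 : ℕ) : ℝ), hh, h0, h1] at this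
    push_cast at this
    rw [this, sub_zero]
  have hb : ∀ n j, b n j ∈ Ioo (0 : ℝ) 1 := fun n j => by
    have := hpos n
    refine ⟨by positivity, ?_⟩
    rw [← hh n, mul_comm (h n)]
    have hj : ((j : ℕ) : ℝ) ≤ n := by exact_mod_cast Nat.lt_succ_iff.1 j.isLt
    refine mul_lt_mul_of_pos_right ?_ this
    push_cast
    linarith
  refine IsMixtureLimit.of_tendsto
    (fun n => isMixtureLimit_steps hφ (hwm n) (hw0 n) (hw1 n) (hb n)) (fun n => ?_)
    (fun n x => abs_sum_mul_le_one (hw0 n x.1) (hw1 n x.1) fun j => ?_) ?_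
  · have := hwm n
    refine Finset.measurable_sum _ fun j _ => Measurable.mul (by fun_prop) ?_
    exact Measurable.ite (measurableSet_lt measurable_const measurable_snd) measurable_const
      measurable_const
  · split_ifs <;> simp
  · have hmeas : MeasurableSet {x : (Fin k → ℝ) × ℝ | Tendsto (fun n => ∑ j, w n x.1 j *
        if b n j < x.2 then 1 else 0) atTop (𝓝 (Function.uncurry p x))} := by
      refine measurableSet_tendsto_fun (fun n => ?_) hpm
      have := hwm n
      refine Finset.measurable_sum _ fun j _ => Measurable.mul (by fun_prop) ?_
      exact Measurable.ite (measurableSet_lt measurable_const measurable_snd) measurable_const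
        measurable_const
    rw [Measure.ae_prod_iff_ae_ae hmeas]
    refine ae_of_all _ fun z => ?_
    have hcont : ∀ᵐ s ∂unif, ContinuousAt (p z) s :=
      ae_restrict_of_ae ((hp z).countable_not_continuousAt.ae_notMem volume |>.mono
        fun s hs => not_not.1 hs)
    filter_upwards [hcont] with s hs
    have hmem := fun n => step_mem_Icc (hp z) (hp0 z) (hp1 z) (h0 z) (h1 z) (hh n) (hpos n) s
    refine tendsto_of_tendsto_of_tendsto_of_le_of_le ?_ ?_ (fun n => (hmem n).1)
      fun n => (hmem n).2
    · exact hs.tendsto.comp (by simpa using hlim.const_sub s)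
    · exact hs.tendsto.comp (by simpa using hlim.const_add s)

/-! ### Prescribing the number of units. -/

/-- The network whose outputs are copies of the outputs of `N`, shifted by constants. -/
def MLP.reindex {k q q' : ℕ} (N : MLP k q) (e : Fin q' → Fin q) (c : Fin q' → ℝ) : MLP k q' :=
  ⟨N.width, N.W₁, N.c₁, fun j => N.W₂ (e j), fun j => N.c₂ (e j) + c j⟩

theorem MLP.eval_reindex {k q q' : ℕ} (N : MLP k q) (e : Fin q' → Fin q) (c : Fin q' → ℝ)
    (z : Fin k → ℝ) (j : Fin q') :
    (N.reindex e c).eval φ z j = N.eval φ z (e j) + c j :=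
  (add_assoc _ _ _).symm

/-- A mixture with `n` units is a mixture with any larger number of units: the weight of a unit
is shared equally among its copies. -/
theorem exists_netMixture_eq {k n n' : ℕ} (hn : n ≤ n') (Nw Nb Nτ : MLP k (n + 1)) :
    ∃ Nw' Nb' Nτ' : MLP k (n' + 1), netMixture φ Nw' Nb' Nτ' = netMixture φ Nw Nb Nτ := by
  classical
  -- All surplus indices become copies of the last unit.
  let e : Fin (n' + 1) → Fin (n + 1) := fun j => ⟨min j n, by omega⟩
  have he : Function.Surjective e := fun i => ⟨⟨i, by omega⟩, by ext; simp [e]; omega⟩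
  let d : Fin (n + 1) → ℝ := fun i => ((Finset.univ.filter fun j => e j = i).card : ℝ)
  have hd : ∀ i, 0 < d i := fun i => by
    obtain ⟨j, hj⟩ := he i
    exact Nat.cast_pos.2 (Finset.card_pos.2 ⟨j, by simp [hj]⟩)
  have hsum : ∀ F : Fin (n + 1) → ℝ, ∑ j, F (e j) / d (e j) = ∑ i, F i := by
    intro F
    rw [← Finset.sum_fiberwise Finset.univ e]
    refine Finset.sum_congr rfl fun i _ => ?_
    have hi : ∀ j ∈ Finset.univ.filter fun j => e j = i, F (e j) / d (e j) = F i / d i :=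
      fun j hj => by rw [(Finset.mem_filter.1 hj).2]
    refine (Finset.sum_congr rfl hi).trans ?_
    rw [Finset.sum_const, nsmul_eq_mul]
    exact mul_div_cancel₀ _ (hd i).ne'
  -- Subtracting the log of the number of copies divides each exponential by that number, so the
  -- softmax normaliser is unchanged.
  refine ⟨Nw.reindex e fun j => -Real.log (d (e j)), Nb.reindex e 0, Nτ.reindex e 0, ?_⟩
  ext p
  simp only [netMixture, mixture, softmax, MLP.eval_reindex, Pi.zero_apply, add_zero, Real.exp_add,
    Real.exp_neg, Real.exp_log (hd _), ← div_eq_mul_inv]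
  rw [hsum fun i => Real.exp (Nw.eval φ p.1 i)]
  refine Eq.trans ?_ (hsum fun i => Real.exp (Nw.eval φ p.1 i) /
    (∑ i, Real.exp (Nw.eval φ p.1 i)) * Real.sigmoid ((p.2 - Real.sigmoid (Nb.eval φ p.1 i)) /
      Real.exp (Nτ.eval φ p.1 i)))
  refine Finset.sum_congr rfl fun j _ => ?_
  ring

/-- Take near-optimal networks for each number of units. By padding, an approximant with `n₀ + 1`
units bounds the optimal error for every larger number. -/
theorem IsMixtureLimit.exists_seq {k : ℕ} {g : (Fin k → ℝ) × ℝ → ℝ} (hg : IsMixtureLimit φ g) :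
    ∃ Nw Nb Nτ : (n : ℕ) → MLP k (n + 1), Tendsto (fun n =>
      ∫⁻ p, ‖netMixture φ (Nw n) (Nb n) (Nτ n) p - g p‖ₑ ∂(cube k).prod unif) atTop (𝓝 0) := by
  let err : (n : ℕ) → MLP k (n + 1) × MLP k (n + 1) × MLP k (n + 1) → ENNReal := fun n N =>
    ∫⁻ p, ‖netMixture φ N.1 N.2.1 N.2.2 p - g p‖ₑ ∂(cube k).prod unif
  have hex : ∀ n, ∃ N, err n N ≤ (⨅ N, err n N) + ((n : ENNReal) + 1)⁻¹ := by
    intro n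
    by_cases htop : (⨅ N, err n N) = ⊤
    · exact ⟨⟨.const k 0, .const k 0, .const k 0⟩, by simp [htop]⟩
    · have := ENNReal.lt_add_right htop
        (ENNReal.inv_ne_zero.2 (show (n : ENNReal) + 1 ≠ ⊤ by finiteness))
      obtain ⟨N, hN⟩ := iInf_lt_iff.1 this
      exact ⟨N, hN.le⟩
  choose N hN using hex
  refine ⟨fun n => (N n).1, fun n => (N n).2.1, fun n => (N n).2.2, ?_⟩
  have hinf : Tendsto (fun n => ⨅ N, err n N) atTop (𝓝 0) := by
    refine ENNReal.tendsto_nhds_zero.2 fun ε hε => ?_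
    obtain ⟨n₀, Nw, Nb, Nτ, h⟩ := hg ε hε
    filter_upwards [eventually_ge_atTop n₀] with n hn
    obtain ⟨Nw', Nb', Nτ', h'⟩ := exists_netMixture_eq (φ := φ) hn Nw Nb Nτ
    refine (iInf_le _ (Nw', Nb', Nτ')).trans (le_trans ?_ h.le)
    simp only [err, h', le_refl]
  have hinv : Tendsto (fun n : ℕ => ((n : ENNReal) + 1)⁻¹) atTop (𝓝 0) := by
    have := (tendsto_add_atTop_iff_nat 1).2 ENNReal.tendsto_inv_nat_nhds_zero
    simpa using this
  exact tendsto_of_tendsto_of_tendsto_of_le_of_le tendsto_const_nhds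
    (by simpa using hinf.add hinv) (fun _ => zero_le) hN

/-! ### From pre-logits to DSF maps. -/

theorem continuousAt_logit {p : ℝ} (hp : p ∈ Ioo (0 : ℝ) 1) : ContinuousAt logit p := by
  unfold logit
  have h1 : 1 - p ≠ 0 := (sub_pos.2 hp.2).ne'
  refine ContinuousAt.log (continuousAt_id.div (by fun_prop) h1) ?_
  exact div_ne_zero hp.1.ne' h1

theorem measurable_logit : Measurable logit := by
  unfold logit
  fun_prop

/-- The sigmoid of a function on `(0,1)`, extended by `0` and `1` to `ℝ`. -/
noncomputable def sigmoidExtend (q : ℝ → ℝ) (s : ℝ) : ℝ :=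
  if s ≤ 0 then 0 else if 1 ≤ s then 1 else Real.sigmoid (q s)

theorem sigmoidExtend_of_mem {q : ℝ → ℝ} {s : ℝ} (hs : s ∈ Ioo (0 : ℝ) 1) :
    sigmoidExtend q s = Real.sigmoid (q s) := by
  rw [sigmoidExtend, if_neg hs.1.not_ge, if_neg hs.2.not_ge]

theorem sigmoidExtend_nonneg (q : ℝ → ℝ) (s : ℝ) : 0 ≤ sigmoidExtend q s := by
  have := Real.sigmoid_nonneg (q s)
  unfold sigmoidExtend
  split_ifs <;> simp [this]

theorem sigmoidExtend_le_one (q : ℝ → ℝ) (s : ℝ) : sigmoidExtend q s ≤ 1 := by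
  have := Real.sigmoid_le_one (q s)
  unfold sigmoidExtend
  split_ifs <;> simp [this]

theorem sigmoidExtend_monotone {q : ℝ → ℝ} (hq : MonotoneOn q (Ioo 0 1)) :
    Monotone (sigmoidExtend q) := by
  intro s s' hss
  rcases le_or_gt s 0 with h | h
  · simpa [sigmoidExtend, h] using sigmoidExtend_nonneg q s'
  rcases le_or_gt 1 s' with h' | h'
  · have : sigmoidExtend q s' = 1 := by simp [sigmoidExtend, h', (h.trans_le hss).not_ge]
    rw [this]
    exact sigmoidExtend_le_one q s
  · have hs : s ∈ Ioo (0 : ℝ) 1 := ⟨h, hss.trans_lt h'⟩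
    have hs' : s' ∈ Ioo (0 : ℝ) 1 := ⟨h.trans_le hss, h'⟩
    rw [sigmoidExtend_of_mem hs, sigmoidExtend_of_mem hs']
    exact Real.sigmoid_monotone (hq hs hs' hss)

theorem isMixtureLimit_sigmoidExtend (hφ : IsSigmoidal φ) {k : ℕ} {q : (Fin k → ℝ) → ℝ → ℝ}
    (hqm : Measurable (Function.uncurry q)) (hq : ∀ z, MonotoneOn (q z) (Ioo 0 1)) :
    IsMixtureLimit φ (Function.uncurry fun z => sigmoidExtend (q z)) := by
  refine isMixtureLimit_monotone hφ ?_ (fun z => sigmoidExtend_monotone (hq z))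
    (fun z => sigmoidExtend_nonneg _) (fun z => sigmoidExtend_le_one _)
    (fun z => by simp [sigmoidExtend]) (fun z => by simp [sigmoidExtend])
  refine Measurable.ite (measurableSet_le measurable_snd measurable_const) measurable_const
    (Measurable.ite (measurableSet_le measurable_const measurable_snd) measurable_const ?_)
  exact continuous_sigmoid.measurable.comp hqm

namespace DSF

variable {m n : ℕ} (D : DSF m (n + 1))

/-- The vector of the pre-logits of a DSF map. -/
noncomputable def prelogits (φ : ℝ → ℝ) (x : Fin m → ℝ) : Fin m → ℝ :=
  fun t => D.prelogit φ t (x t) (prefixOf x t)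

theorem prelogit_eq_netMixture (t : Fin m) (s : ℝ) (z : Fin (t : ℕ) → ℝ) :
    D.prelogit φ t s z = netMixture φ (D.wNet t) (D.bNet t) (D.τNet t) (z, s) := rfl

theorem measurable_prelogits (hφ : Continuous φ) : Measurable (D.prelogits φ) := by
  refine measurable_pi_iff.2 fun t => ?_
  simp only [prelogits, prelogit_eq_netMixture]
  exact (measurable_netMixture hφ (D.wNet t) (D.bNet t) (D.τNet t)).comp
    ((measurable_prefixOf t).prodMk (measurable_pi_apply t))

theorem measurable_eval (hφ : Continuous φ) : Measurable (D.eval φ) :=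
  measurable_pi_iff.2 fun t => measurable_logit.comp
    ((measurable_pi_apply t).comp (D.measurable_prelogits hφ))

end DSF

/-- Measurable triangular maps that are increasing in the last coordinate are limits in measure
of autoregressive DSF maps. -/
theorem exists_dsf_tendstoInMeasure (hφ : IsSigmoidal φ) {m : ℕ} {T : (Fin m → ℝ) → (Fin m → ℝ)}
    (hT : ∀ t : Fin m, ∃ q : (Fin (t : ℕ) → ℝ) → ℝ → ℝ, Measurable (Function.uncurry q) ∧
        (∀ z, MonotoneOn (q z) (Ioo 0 1)) ∧ ∀ x, T x t = q (prefixOf x t) (x t)) :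
    ∃ G : (n : ℕ) → DSF m (n + 1),
      TendstoInMeasure (cube m) (fun n => (G n).eval φ) atTop T := by
  choose q hqm hq hqT using hT
  have hTm : Measurable T := measurable_pi_iff.2 fun t => by
    simp only [hqT]
    exact (hqm t).comp ((measurable_prefixOf t).prodMk (measurable_pi_apply t))
  choose Nw Nb Nτ hN using fun t => (isMixtureLimit_sigmoidExtend hφ (hqm t) (hq t)).exists_seq
  let G : (n : ℕ) → DSF m (n + 1) := fun n => ⟨fun t => Nw t n, fun t => Nb t n, fun t => Nτ t n⟩
  let p : (Fin m → ℝ) → Fin m → ℝ := fun x t => Real.sigmoid (T x t)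
  have hpm : Measurable p := measurable_pi_iff.2 fun t =>
    continuous_sigmoid.measurable.comp ((measurable_pi_apply t).comp hTm)
  have hcoord : ∀ t, Tendsto (fun n => ∫⁻ x, ‖(G n).prelogits φ x t - p x t‖ₑ ∂cube m) atTop
      (𝓝 0) := by
    intro t
    refine (hN t).congr fun n => ?_
    have hpt : Measurable (Function.uncurry fun z => Real.sigmoid ∘ q t z) :=
      continuous_sigmoid.measurable.comp (hqm t)
    have hae : ∀ᵐ y ∂(cube (t : ℕ)).prod unif, y.2 ∈ Ioo (0 : ℝ) 1 :=
      Measure.quasiMeasurePreserving_snd.ae (ae_restrict_mem measurableSet_Ioo)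
    calc _ = ∫⁻ y, ‖netMixture φ (Nw t n) (Nb t n) (Nτ t n) y - Real.sigmoid (q t y.1 y.2)‖ₑ
          ∂(cube (t : ℕ)).prod unif := by
          refine lintegral_congr_ae ?_
          filter_upwards [hae] with y hy
          rw [Function.uncurry, sigmoidExtend_of_mem hy]
      _ = _ := by
          have hd : Measurable fun y : (Fin (t : ℕ) → ℝ) × ℝ =>
              ‖netMixture φ (Nw t n) (Nb t n) (Nτ t n) y - Real.sigmoid (q t y.1 y.2)‖ₑ :=
            ((measurable_netMixture hφ.continuous _ _ _).sub hpt).enorm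
          rw [← map_prefixOf_cube, lintegral_map hd
            ((measurable_prefixOf t).prodMk (measurable_pi_apply t))]
          simp only [p, hqT]
          rfl
  have hL : Tendsto (fun n => eLpNorm ((G n).prelogits φ - p) 1 (cube m)) atTop (𝓝 0) := by
    have hsum := tendsto_finsetSum Finset.univ fun t _ => hcoord t
    rw [Finset.sum_const_zero] at hsum
    refine tendsto_of_tendsto_of_tendsto_of_le_of_le tendsto_const_nhds hsum
      (fun _ => zero_le) fun n => ?_
    have hm := (G n).measurable_prelogits hφ.continuous
    dsimp only
    rw [eLpNorm_one_eq_lintegral_enorm, ← lintegral_finsetSum _ fun t _ => by fun_prop]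
    refine lintegral_mono fun x => ?_
    rw [Pi.sub_apply, ← edist_eq_enorm_sub]
    refine edist_pi_le_iff.2 fun t => ?_
    rw [edist_eq_enorm_sub]
    exact Finset.single_le_sum (f := fun t => ‖(G n).prelogits φ x t - p x t‖ₑ)
      (fun _ _ => zero_le) (Finset.mem_univ t)
  have hmeas : TendstoInMeasure (cube m) (fun n => (G n).prelogits φ) atTop p :=
    tendstoInMeasure_of_tendsto_eLpNorm one_ne_zero
      (fun n => ((G n).measurable_prelogits hφ.continuous).aestronglyMeasurable)
      hpm.aestronglyMeasurable hL
  refine ⟨G, ?_⟩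
  -- Since `logit` is continuous but not uniformly so on `(0,1)`, the limit passes through it along
  -- a.e. convergent subsequences; the limit `p x t` is always interior.
  rw [exists_seq_tendstoInMeasure_atTop_iff
    fun n => ((G n).measurable_eval hφ.continuous).aestronglyMeasurable]
  intro ns hns
  obtain ⟨ns', hns', hlim⟩ := (exists_seq_tendstoInMeasure_atTop_iff fun n =>
    ((G n).measurable_prelogits hφ.continuous).aestronglyMeasurable).1 hmeas ns hns
  refine ⟨ns', hns', ?_⟩
  filter_upwards [hlim] with x hx
  refine tendsto_pi_nhds.2 fun t => ?_
  have h1 := (continuousAt_logit (p := p x t)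
    ⟨Real.sigmoid_pos _, Real.sigmoid_lt_one _⟩).tendsto.comp (tendsto_pi_nhds.1 hx t)
  rwa [logit_sigmoid] at h1

end NAF

theorem mainTheorem2 {Ω Ω' : Type*} [MeasurableSpace Ω] [MeasurableSpace Ω']
    (P : Measure Ω) [IsProbabilityMeasure P] (P' : Measure Ω') [IsProbabilityMeasure P']
    (m : ℕ)
    (Y : Ω' → Fin m → ℝ) (f : (Fin m → ℝ) → ℝ)
    (hf_cont : Continuous f) (hf_pos : ∀ y, 0 < f y)
    (hY : ProbabilityTheory.HasLaw Y
      ((volume : Measure (Fin m → ℝ)).withDensity fun y => ENNReal.ofReal (f y)) P')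
    (X : Ω → Fin m → ℝ)
    (hX : pdf.IsUniform X (Set.univ.pi fun _ : Fin m => Set.Ioo (0 : ℝ) 1) P volume)
    (φ : ℝ → ℝ) (hφ : NAF.IsSigmoidal φ) :
    ∃ G : (n : ℕ) → NAF.DSF m (n + 1),
      TendstoInDistribution (fun n ω => (G n).eval φ (X ω)) atTop Y (fun _ => P) P' := by
  have hXm : AEMeasurable X P := pdf.IsUniform.aemeasurable
    (by rw [volume_pi, Measure.pi_pi]; simp) (by rw [volume_pi, Measure.pi_pi]; simp) hX
  have hXlaw : P.map X = NAF.cube m := Eq.trans hX (NAF.cond_volume_eq_cube m)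
  have hYp : IsProbabilityMeasure (P'.map Y) := Measure.isProbabilityMeasure_map hY.aemeasurable
  obtain ⟨T, hTm, hTY, hT⟩ := NAF.exists_triangular_map m (P'.map Y)
  obtain ⟨G, hG⟩ := NAF.exists_dsf_tendstoInMeasure hφ hT
  have hGm := fun n => (G n).measurable_eval hφ.continuous
  have hdist := hG.tendstoInDistribution (fun n => (hGm n).aemeasurable)
  refine ⟨G, fun n => (hGm n).comp_aemeasurable hXm, hY.aemeasurable, ?_⟩
  -- Only laws matter: the limit `T` on the cube has the law of `Y`, and `X` has the law `cube m`.
  have key := hdist.tendsto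
  have hlaw : ∀ n, (P.map X).map ((G n).eval φ) = P.map fun ω => (G n).eval φ (X ω) := fun n =>
    AEMeasurable.map_map_of_aemeasurable (hGm n).aemeasurable hXm
  simp only [hTY] at key
  refine key.congr fun n => Subtype.ext ?_
  exact (congrArg (Measure.map _) hXlaw).symm.trans (hlaw n)
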